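/- Let $\mathcal X$ be a finite set and let $W=(W(x|\bar x))_{x,\bar x\in\mathcal X}$ be a transition matrix ($W(x|\bar x)\ge 0$, $\sum_x W(x|\bar x)=1$) which is irreducible (for all $x,\bar x$ there is $k\ge1$ with $W^k(x|\bar x)>0$) and ergodic (there are no $\bar x$ and no integer $d\ge 2$ such that $W^k(\bar x|\bar x)=0$ for every $k$ not divisible by $d$). Let $g:\mathcal X\times\mathcal X\to\mathbb R$ be such that there are no $f:\mathcal X\to\mathbb R$ and $c\in\mathbb R$ with $g(x,\bar x)=f(x)-f(\bar x)+c$ for all $(x,\bar x)$ with $W(x|\bar x)>0$. For $\theta\in\mathbb R$ let $\phi(\theta)=\log\lambda_\theta$, where $\lambda_\theta$ is the Perron–Frobenius eigenvalue (spectral radius) of the matrix $\bigl(W(x|\bar x)e^{\theta g(x,\bar x)}\bigr)_{x,\bar x}$, and let $\eta(0)=\phi'(0)$. Let $P$ be an arbitrary probability distribution on $\mathcal X$, let $h:\mathcal X\to\mathbb R$ be an arbitrary function, let $X_1,X_2,\dots$ be the Markov chain with initial distribution $P$ and transition matrix $W$, and put $$\tilde g^n=\tilde g^n(X_1,\dots,X_{n+1})=\sum_{i=1}^n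 g(X_{i+1},X_i)+h(X_1).$$ Then $\phi$ is twice continuously differentiable near $0$ with $\phi''(0)>0$, and for all $t\in(0,1/2)$ and $\delta>0$, $$\lim_{n\to\infty}-\frac1{n^{1-2t}}\log \Pr\{\tilde g^n-n\eta(0)\ge n^{1-t}\delta\}=\frac{\delta^2}{2\phi''(0)},$$ $$\lim_{n\to\infty}-\frac1{n^{1-2t}}\log \Pr\{\tilde g^n-n\eta(0)\le -n^{1-t}\delta\}=\frac{\delta^2}{2\phi''(0)}.$$ -/

import Mathlib

open Filter Topology

noncomputable section

namespace MarkovMDP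

variable {X : Type*} [Fintype X]

/-- Transition matrices are indexed as `W x x'`, the probability of moving from `x'` to `x`, so
each column sums to one (`W ∈ colStochastic ℝ X`).  An irreducible matrix is ergodic if no state
has all its return times divisible by a common integer `d ≥ 2`. -/
def IsErgodic [DecidableEq X] (W : Matrix X X ℝ) : Prop :=
  W.IsIrreducible ∧
    ¬ ∃ (x : X) (d : ℕ), 2 ≤ d ∧ ∀ k : ℕ, ¬ d ∣ k → (W ^ k) x x = 0

/-- The Perron-Frobenius eigenvalue of an entrywise nonnegative real matrix, i.e. its spectral
radius: the largest modulus of a complex eigenvalue. -/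
def perronEigenvalue [DecidableEq X] (A : Matrix X X ℝ) : ℝ :=
  (spectralRadius ℂ (A.map Complex.ofReal)).toReal

/-- The tilted matrix `W(x|x') exp (θ g(x,x'))`. -/
def tilted (W : Matrix X X ℝ) (g : X → X → ℝ) (θ : ℝ) : Matrix X X ℝ :=
  Matrix.of fun x x' => W x x' * Real.exp (θ * g x x')

/-- The potential function: the logarithm of the Perron-Frobenius eigenvalue of the tilted
matrix. -/
def potential [DecidableEq X] (W : Matrix X X ℝ) (g : X → X → ℝ) (θ : ℝ) : ℝ :=
  Real.log (perronEigenvalue (tilted W g θ))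

/-- `g` is nondegenerate for `W` if on the support of `W` it is not of the form
`f(x) - f(x') + c`. -/
def Nondegenerate (W : Matrix X X ℝ) (g : X → X → ℝ) : Prop :=
  ¬ ∃ (f : X → ℝ) (c : ℝ), ∀ x x' : X, 0 < W x x' → g x x' = f x - f x' + c

/-- The probability of the path `x 0, x 1, …, x n` for the Markov chain with initial distribution
`P` and transition matrix `W`. -/
def pathWeight (W : Matrix X X ℝ) (P : X → ℝ) (n : ℕ) (x : Fin (n + 1) → X) : ℝ :=
  (∏ i : Fin n, W (x i.succ) (x i.castSucc)) * P (x 0)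

/-- The probability of an event about the first `n + 1` states of that chain. -/
def pathProb (W : Matrix X X ℝ) (P : X → ℝ) (n : ℕ) (E : Set (Fin (n + 1) → X)) : ℝ :=
  ∑ x : Fin (n + 1) → X, E.indicator (pathWeight W P n) x

/-- The additive functional: the sum of `g` over the `n` transitions, plus `h` of the initial
state. -/
def additive (g : X → X → ℝ) (h : X → ℝ) (n : ℕ) (x : Fin (n + 1) → X) : ℝ :=
  (∑ i : Fin n, g (x i.succ) (x i.castSucc)) + h (x 0)

end MarkovMDP

end

/-!
Let `φ` be the potential and `v = φ''(0)`.

For `θ` near `0` the transposed tilted matrix has a positive eigenvector `u θ`, depending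
smoothly on `θ`, with eigenvalue `exp (φ θ)`. It is obtained by continuing the eigenpair `(1, 1)`
of the transposed transition matrix with the implicit function theorem
(`exists_smooth_eigenpair`); the linearized equations are invertible by the maximum principle for
irreducible chains (`const_of_superharmonic`). A positive left eigenvector forces its eigenvalue to
be the spectral radius (`perronEigenvalue_eq_of_pos_eigenvector`), so `φ` is `C²` at `0`.

With `w = log u`, the exponential weights
`W x x' * exp (θ * g x x' + w θ x - w θ x' - φ θ)` have column sums `1`
(`exists_log_eigenvector`). Differentiating this identity twice at `θ = 0` gives
`∑ x, W x x' * (g x x' + w' x - w' x' - φ')² + ∑ x, W x x' * w'' x = w'' x' + φ''`.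
If `φ'' ≤ 0`, then `w''` is superharmonic, hence constant, and the squares vanish on the support of
`W`, so that `g` is degenerate (`deriv_deriv_potential_pos`).

Summing over paths with `u θ` as terminal weight multiplies the total by `exp (φ θ)` per step, so
the cumulant generating function of the additive functional is `n * φ θ + O(1)`, uniformly near
`θ = 0` (`log_mgf_additive_bound`). At the tilt `s * n ^ (-t)` the second-order expansion of `φ`
turns this into the limit `v * s² / 2` at speed `n ^ (1 - 2 * t)` (`tendsto_scaled_cgf`). Such a
quadratic limit implies the Gaussian rate for the upper tail
(`tendsto_log_tail_of_quadratic_cgf`): the upper bound is the exponential Markov inequality, and for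
the lower bound the weights are tilted so that their mass concentrates just above the threshold.
The lower tail is the upper tail for `-g` and `-h`.
-/

/-! ### Second-order calculus at a point -/

theorem ContDiffAt.eventually_hasDerivAt_deriv {f : ℝ → ℝ} {a : ℝ}
    (hf : ContDiffAt ℝ 2 f a) : ∀ᶠ x in 𝓝 a, HasDerivAt f (deriv f x) x := by
  filter_upwards [hf.eventually (by simp)] with x hx
  exact (hx.differentiableAt two_ne_zero).hasDerivAt

theorem ContDiffAt.hasDerivAt_deriv_deriv {f : ℝ → ℝ} {a : ℝ}
    (hf : ContDiffAt ℝ 2 f a) : HasDerivAt (deriv f) (deriv (deriv f) a) a := by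
  have : ContDiffAt ℝ 1 (deriv f) a := hf.derivWithin (m := 1) le_rfl
  exact (this.differentiableAt one_ne_zero).hasDerivAt

/-- The second-order Taylor expansion at `0`, in the Peano form. -/
theorem ContDiffAt.isLittleO_sq_sub_taylor {f : ℝ → ℝ} (hf : ContDiffAt ℝ 2 f 0)
    (h0 : f 0 = 0) :
    (fun x => f x - deriv f 0 * x - deriv (deriv f) 0 * x ^ 2 / 2) =o[𝓝 0] fun x => x ^ 2 := by
  have hd := (hasDerivAt_iff_isLittleO.1 hf.hasDerivAt_deriv_deriv)
  rw [Asymptotics.isLittleO_iff]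
  intro c hc
  obtain ⟨r, hr, hball⟩ := Metric.eventually_nhds_iff.1
    ((hd.bound hc).and hf.eventually_hasDerivAt_deriv)
  refine Metric.eventually_nhds_iff.2 ⟨r, hr, fun x hx => ?_⟩
  have hsub : ∀ y ∈ Metric.closedBall (0 : ℝ) |x|, Dist.dist y 0 < r := fun y hy =>
    lt_of_le_of_lt (Metric.mem_closedBall.1 hy) (by simpa [Real.dist_eq] using hx)
  have hder : ∀ y ∈ Metric.closedBall (0 : ℝ) |x|, HasDerivWithinAt
      (fun x => f x - deriv f 0 * x - deriv (deriv f) 0 * x ^ 2 / 2)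
      (deriv f y - deriv f 0 - deriv (deriv f) 0 * y) (Metric.closedBall (0 : ℝ) |x|) y := by
    intro y hy
    have h1 := (hball (hsub y hy)).2
    have h2 := (h1.sub ((hasDerivAt_id y).const_mul (deriv f 0))).sub
      ((((hasDerivAt_id y).pow 2).const_mul (deriv (deriv f) 0)).div_const 2)
    refine (h2.congr_deriv ?_).hasDerivWithinAt
    simp; ring
  have hbd : ∀ y ∈ Metric.closedBall (0 : ℝ) |x|,
      ‖deriv f y - deriv f 0 - deriv (deriv f) 0 * y‖ ≤ c * |x| := by
    intro y hy
    have h1 := (hball (hsub y hy)).1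
    have h2 : |y| ≤ |x| := by simpa using hy
    simp only [sub_zero, smul_eq_mul, Real.norm_eq_abs] at h1 ⊢
    rw [mul_comm y] at h1
    exact h1.trans (mul_le_mul_of_nonneg_left h2 hc.le)
  have h3 := (convex_closedBall (0 : ℝ) |x|).norm_image_sub_le_of_norm_hasDerivWithin_le hder hbd
    (Metric.mem_closedBall_self (abs_nonneg x)) (show x ∈ Metric.closedBall (0 : ℝ) |x| by simp)
  simpa [h0, sq, mul_assoc] using h3

/-- If `exp ∘ ψ i` is averaged to `1` by the weights `c i` and all `ψ i` vanish at `0`, then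
the first two derivatives of the average at `0` give `∑ c i (ψ i)'' = -∑ c i ((ψ i)')²`. -/
theorem sum_deriv_sq_add_deriv_deriv {ι : Type*} (s : Finset ι) (c : ι → ℝ)
    {ψ ψ' : ι → ℝ → ℝ} {ψ'' : ι → ℝ} (h0 : ∀ i, ψ i 0 = 0)
    (h1 : ∀ i, ∀ᶠ θ in 𝓝 0, HasDerivAt (ψ i) (ψ' i θ) θ)
    (h2 : ∀ i, HasDerivAt (ψ' i) (ψ'' i) 0)
    (h : ∀ᶠ θ in 𝓝 0, ∑ i ∈ s, c i * Real.exp (ψ i θ) = 1) :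
    ∑ i ∈ s, c i * (ψ' i 0 ^ 2 + ψ'' i) = 0 := by
  have hfirst : ∀ᶠ θ in 𝓝 0, ∑ i ∈ s, c i * (Real.exp (ψ i θ) * ψ' i θ) = 0 := by
    have h1' : ∀ᶠ θ in 𝓝 0, ∀ i ∈ s, HasDerivAt (ψ i) (ψ' i θ) θ :=
      (Filter.eventually_all_finset s).2 fun i _ => h1 i
    filter_upwards [h1', h.eventually_nhds] with θ hθ hc
    have hd := HasDerivAt.fun_sum fun i hi => ((hθ i hi).exp).const_mul (c i)
    exact hd.unique ((hasDerivAt_const θ (1 : ℝ)).congr_of_eventuallyEq hc)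
  have hd : HasDerivAt (fun θ => ∑ i ∈ s, c i * (Real.exp (ψ i θ) * ψ' i θ))
      (∑ i ∈ s, c i * (Real.exp (ψ i 0) * ψ' i 0 * ψ' i 0 + Real.exp (ψ i 0) * ψ'' i)) 0 :=
    HasDerivAt.fun_sum fun i _ =>
      (((h1 i).self_of_nhds.exp).mul (h2 i)).const_mul (c i)
  have := hd.unique ((hasDerivAt_const (0 : ℝ) (0 : ℝ)).congr_of_eventuallyEq hfirst)
  simpa [h0, sq] using this

namespace MarkovMDP

/-! ### Moderate deviations from a quadratic limit of cumulant generating functions -/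

theorem eventually_exp_bounds_of_tendsto_log {a p : ℕ → ℝ} {L : ℝ} (ha : ∀ᶠ n in atTop, 0 < a n)
    (hp : ∀ᶠ n in atTop, 0 < p n)
    (h : Tendsto (fun n => 1 / a n * Real.log (p n)) atTop (𝓝 L)) {ε : ℝ} (hε : 0 < ε) :
    ∀ᶠ n in atTop, Real.exp (a n * (L - ε)) ≤ p n ∧ p n ≤ Real.exp (a n * (L + ε)) := by
  filter_upwards [ha, hp, h.eventually (lt_mem_nhds (sub_lt_self L hε)),
    h.eventually (gt_mem_nhds (lt_add_of_pos_right L hε))] with n h1 h2 h3 h4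
  rw [one_div_mul_eq_div] at h3 h4
  rw [← Real.le_log_iff_exp_le h2, ← Real.log_le_iff_le_exp h2]
  exact ⟨by rw [lt_div_iff₀ h1] at h3; linarith, by rw [div_lt_iff₀ h1] at h4; linarith⟩

theorem tendsto_log_of_eventually_exp_bounds {a p : ℕ → ℝ} {L : ℝ} (ha : ∀ᶠ n in atTop, 0 < a n)
    (h : ∀ ε > 0, ∀ᶠ n in atTop,
      Real.exp (a n * (L - ε)) ≤ p n ∧ p n ≤ Real.exp (a n * (L + ε))) :
    Tendsto (fun n => 1 / a n * Real.log (p n)) atTop (𝓝 L) := by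
  rw [Metric.tendsto_atTop']
  intro ε hε
  have := (ha.and (h (ε / 2) (by positivity))).exists_forall_of_atTop
  obtain ⟨N, hN⟩ := this
  refine ⟨N, fun n hn => ?_⟩
  obtain ⟨h1, h2, h3⟩ := hN n hn.le
  have h4 : 0 < p n := (Real.exp_pos _).trans_le h2
  rw [← Real.le_log_iff_exp_le h4] at h2
  rw [← Real.log_le_iff_le_exp h4] at h3
  rw [Real.dist_eq, one_div_mul_eq_div, abs_lt, lt_sub_iff_add_lt, sub_lt_iff_lt_add,
    lt_div_iff₀ h1, div_lt_iff₀ h1]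
  constructor <;> nlinarith

section

variable {ι : Type*} [Fintype ι] {w Y : ι → ℝ}

/-- The exponential Markov inequality. -/
theorem sum_indicator_le_exp_mul_mgf (hw : ∀ x, 0 ≤ w x) {s : ℝ} (hs : 0 ≤ s) (δ : ℝ) :
    ∑ x, {x | δ ≤ Y x}.indicator w x ≤
      Real.exp (-(s * δ)) * ∑ x, w x * Real.exp (s * Y x) := by
  rw [Finset.mul_sum]
  refine Finset.sum_le_sum fun x _ => ?_
  have hnn : 0 ≤ Real.exp (-(s * δ)) * (w x * Real.exp (s * Y x)) := by
    have := hw x; positivity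
  refine Set.indicator_apply_le' (fun hx => ?_) fun _ => hnn
  have h1 : 1 ≤ Real.exp (-(s * δ) + s * Y x) :=
    Real.one_le_exp (by nlinarith [mul_le_mul_of_nonneg_left (show δ ≤ Y x from hx) hs])
  calc w x = w x * 1 := (mul_one _).symm
    _ ≤ w x * Real.exp (-(s * δ) + s * Y x) := mul_le_mul_of_nonneg_left h1 (hw x)
    _ = _ := by rw [Real.exp_add]; ring

/-- The change-of-measure inequality: under the weights tilted by `s`, all mass off the window
`[δ, δ']` is controlled by the exponential Markov inequality with the tilts `s + r` and `s - r`. -/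
theorem mgf_le_of_tilted_window (hw : ∀ x, 0 ≤ w x) {s r : ℝ} (hs : 0 ≤ s) (hr : 0 ≤ r)
    (δ δ' : ℝ) :
    ∑ x, w x * Real.exp (s * Y x) ≤
      Real.exp (s * δ') * ∑ x, {x | δ ≤ Y x}.indicator w x +
      Real.exp (-(r * δ')) * ∑ x, w x * Real.exp ((s + r) * Y x) +
      Real.exp (r * δ) * ∑ x, w x * Real.exp ((s - r) * Y x) := by
  simp only [Finset.mul_sum, ← Finset.sum_add_distrib]
  refine Finset.sum_le_sum fun x _ => ?_
  have e1 : Real.exp (-(r * δ')) * (w x * Real.exp ((s + r) * Y x)) =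
      w x * Real.exp (s * Y x + r * (Y x - δ')) := by
    rw [mul_left_comm, ← Real.exp_add]; ring_nf
  have e2 : Real.exp (r * δ) * (w x * Real.exp ((s - r) * Y x)) =
      w x * Real.exp (s * Y x + r * (δ - Y x)) := by
    rw [mul_left_comm, ← Real.exp_add]; ring_nf
  rw [e1, e2]
  have hwx := hw x
  have p0 : 0 ≤ Real.exp (s * δ') * {x | δ ≤ Y x}.indicator w x :=
    mul_nonneg (Real.exp_pos _).le (Set.indicator_nonneg (fun y _ => hw y) x)
  have p1 : 0 ≤ w x * Real.exp (s * Y x + r * (Y x - δ')) := by positivity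
  have p2 : 0 ≤ w x * Real.exp (s * Y x + r * (δ - Y x)) := by positivity
  rcases lt_or_ge (Y x) δ with h | h
  · have : w x * Real.exp (s * Y x) ≤ w x * Real.exp (s * Y x + r * (δ - Y x)) := by
      gcongr; nlinarith
    linarith
  rcases lt_or_ge δ' (Y x) with h' | h'
  · have : w x * Real.exp (s * Y x) ≤ w x * Real.exp (s * Y x + r * (Y x - δ')) := by
      gcongr; nlinarith
    linarith
  · have : w x * Real.exp (s * Y x) ≤ Real.exp (s * δ') * {x | δ ≤ Y x}.indicator w x := by
      rw [Set.indicator_of_mem (show x ∈ {x | δ ≤ Y x} from h), mul_comm]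
      gcongr
    linarith

end

/-- If the cumulant generating functions of `Y n`, normalized at speed `a n`, converge to
`s ↦ v * s ^ 2 / 2`, then the upper tails of `Y n` decay at speed `a n` with the Gaussian rate
`δ ^ 2 / (2 * v)`. -/
theorem tendsto_log_tail_of_quadratic_cgf {ι : ℕ → Type*} [∀ n, Fintype (ι n)]
    {w Y : ∀ n, ι n → ℝ} (hw : ∀ n x, 0 ≤ w n x) {a : ℕ → ℝ} (ha : Tendsto a atTop atTop)
    {v : ℝ} (hv : 0 < v)
    (hpos : ∀ s, ∀ᶠ n in atTop, 0 < ∑ x, w n x * Real.exp (a n * s * Y n x))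
    (hM : ∀ s, Tendsto (fun n => 1 / a n * Real.log (∑ x, w n x * Real.exp (a n * s * Y n x)))
      atTop (𝓝 (v * s ^ 2 / 2))) {δ : ℝ} (hδ : 0 < δ) :
    Tendsto (fun n => 1 / a n * Real.log (∑ x, {x | δ ≤ Y n x}.indicator (w n) x)) atTop
      (𝓝 (-(δ ^ 2 / (2 * v)))) := by
  have ha0 : ∀ᶠ n in atTop, 0 < a n := ha.eventually_gt_atTop 0
  have hMb := fun s {ε : ℝ} (hε : 0 < ε) =>
    eventually_exp_bounds_of_tendsto_log ha0 (hpos s) (hM s) hε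
  refine tendsto_log_of_eventually_exp_bounds ha0 fun ε hε => ?_
  refine Eventually.and ?_ ?_
  · -- The tilt `s` centres the tilted weights at `δ + η`, the middle of the window
    -- `[δ, δ + 2 * η]`; the total cost of a positive `η` is at most `2 * η * (δ + 1) / v`.
    set η := min 1 (v * ε / (2 * (δ + 1))) with hη_def
    have hη : 0 < η := by positivity
    have hη1 : η ≤ 1 := min_le_left _ _
    have hη2 : 2 * η * (δ + 1) ≤ v * ε := by
      have := (le_div_iff₀ (by positivity)).1 (min_le_right 1 (v * ε / (2 * (δ + 1))))
      rw [← hη_def] at this; linarith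
    set s := (δ + η) / v with hs_def
    set r := η / v with hr_def
    set κ := η ^ 2 / (8 * v) with hκ_def
    have hs : 0 < s := by positivity
    have hr : 0 < r := by positivity
    have hκ : 0 < κ := by positivity
    have hsmall : ∀ᶠ n in atTop, Real.exp (-(a n * κ)) ≤ 1 / 2 := by
      have h1 : Tendsto (fun n => Real.exp (-(a n * κ))) atTop (𝓝 0) :=
        Real.tendsto_exp_neg_atTop_nhds_zero.comp (ha.atTop_mul_const hκ)
      exact h1.eventually (ge_mem_nhds (by norm_num))
    filter_upwards [ha0, hMb s hκ, hMb (s + r) hκ, hMb (s - r) hκ, hsmall]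
      with n h0 h1 h2 h3 h4
    have hwin := mgf_le_of_tilted_window (w := w n) (Y := Y n) (hw n)
      (s := a n * s) (r := a n * r) (by positivity) (by positivity) δ (δ + 2 * η)
    rw [← mul_add, ← mul_sub] at hwin
    set p := ∑ x, {x | δ ≤ Y n x}.indicator (w n) x
    set y := Real.exp (-(a n * κ)) with hy
    have hy0 : 0 < y := Real.exp_pos _
    set B := Real.exp (a n * (v * s ^ 2 / 2)) with hB
    have hB0 : 0 < B := Real.exp_pos _
    have b1 : B * y ≤ ∑ x, w n x * Real.exp (a n * s * Y n x) := by
      refine le_trans (le_of_eq ?_) h1.1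
      rw [hB, hy, ← Real.exp_add]; ring_nf
    have b2 : Real.exp (-(a n * r * (δ + 2 * η))) *
        ∑ x, w n x * Real.exp (a n * (s + r) * Y n x) ≤ B * y ^ 3 := by
      refine le_trans (mul_le_mul_of_nonneg_left h2.2 (Real.exp_pos _).le) (le_of_eq ?_)
      rw [hB, hy, ← Real.exp_nat_mul, ← Real.exp_add, ← Real.exp_add]
      congr 1
      rw [hs_def, hr_def, hκ_def]; field_simp; ring
    have b3 : Real.exp (a n * r * δ) *
        ∑ x, w n x * Real.exp (a n * (s - r) * Y n x) ≤ B * y ^ 3 := by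
      refine le_trans (mul_le_mul_of_nonneg_left h3.2 (Real.exp_pos _).le) (le_of_eq ?_)
      rw [hB, hy, ← Real.exp_nat_mul, ← Real.exp_add, ← Real.exp_add]
      congr 1
      rw [hs_def, hr_def, hκ_def]; field_simp; ring
    -- Here `y ≤ 1 / 2` makes the mass off the window negligible.
    have b4 : B * y ^ 2 ≤ Real.exp (a n * s * (δ + 2 * η)) * p := by
      have : y ^ 2 + 2 * y ^ 3 ≤ y := by nlinarith [mul_pos hy0 hy0]
      nlinarith [mul_le_mul_of_nonneg_left this hB0.le]
    have b5 : Real.exp (a n * (-(δ ^ 2 / (2 * v)) - ε)) * Real.exp (a n * s * (δ + 2 * η)) ≤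
        B * y ^ 2 := by
      rw [hB, hy, ← Real.exp_nat_mul, ← Real.exp_add, ← Real.exp_add]
      refine Real.exp_le_exp.2 ?_
      have e : a n * (v * s ^ 2 / 2) + ((2 : ℕ) : ℝ) * -(a n * κ) -
          (a n * (-(δ ^ 2 / (2 * v)) - ε) + a n * s * (δ + 2 * η)) =
          a n * ((v * ε - (2 * η * δ + 7 / 4 * η ^ 2)) / v) := by
        rw [hs_def, hκ_def]; push_cast; field_simp; ring
      have : 0 ≤ a n * ((v * ε - (2 * η * δ + 7 / 4 * η ^ 2)) / v) := by
        refine mul_nonneg h0.le (div_nonneg ?_ hv.le)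
        nlinarith
      linarith
    have b6 := b5.trans b4
    rw [mul_comm] at b6
    exact le_of_mul_le_mul_left b6 (Real.exp_pos _)
  · -- The tilt `δ / v` minimizes `v * s ^ 2 / 2 - s * δ`.
    filter_upwards [ha0, hMb (δ / v) hε] with n h0 h1
    refine (sum_indicator_le_exp_mul_mgf (hw n) (s := a n * (δ / v)) (by positivity) δ).trans ?_
    refine (mul_le_mul_of_nonneg_left h1.2 (Real.exp_pos _).le).trans (le_of_eq ?_)
    rw [← Real.exp_add]
    congr 1
    field_simp; ring

/-! ### Sign change of the functional -/

theorem additive_neg {X : Type*} (g : X → X → ℝ) (h : X → ℝ) (n : ℕ) (x : Fin (n + 1) → X) :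
    additive (-g) (-h) n x = -additive g h n x := by
  simp [additive]; ring

theorem Nondegenerate.neg {X : Type*} {W : Matrix X X ℝ} {g : X → X → ℝ}
    (hg : Nondegenerate W g) : Nondegenerate W (-g) := by
  rintro ⟨f, c, h⟩
  refine hg ⟨-f, -c, fun x x' hpos => ?_⟩
  have := h x x' hpos
  simp only [Pi.neg_apply] at this ⊢
  linarith

variable {X : Type*} [Fintype X]

/-! ### The moment generating function along paths -/

/-- Summing over paths with a left eigenvector of the tilted matrix as terminal weight multiplies
the initial value by one eigenvalue per step. -/
theorem sum_pathWeight_mul_exp_mul_eigenvector {W : Matrix X X ℝ} {g : X → X → ℝ} {θ l : ℝ}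
    {u : X → ℝ} (hu : ∀ x', ∑ x, tilted W g θ x x' * u x = l * u x') (P h : X → ℝ) (n : ℕ) :
    ∑ x : Fin (n + 1) → X, pathWeight W P n x * Real.exp (θ * additive g h n x) *
      u (x (Fin.last n)) = l ^ n * ∑ x, P x * Real.exp (θ * h x) * u x := by
  induction n with
  | zero =>
    rw [← (Equiv.funUnique (Fin 1) X).symm.sum_comp]
    simp [pathWeight, additive]
  | succ n ih =>
    rw [← (Fin.snocEquiv fun _ : Fin (n + 2) => X).sum_comp, Fintype.sum_prod_type_right]
    have hstep : ∀ y : Fin (n + 1) → X, ∑ z : X,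
        pathWeight W P (n + 1) (Fin.snocEquiv (fun _ : Fin (n + 2) => X) (z, y)) *
          Real.exp (θ * additive g h (n + 1) (Fin.snocEquiv (fun _ : Fin (n + 2) => X) (z, y))) *
          u (Fin.snocEquiv (fun _ : Fin (n + 2) => X) (z, y) (Fin.last (n + 1))) =
        l * (pathWeight W P n y * Real.exp (θ * additive g h n y) * u (y (Fin.last n))) := by
      intro y
      have h1 : ∀ z : X,
          pathWeight W P (n + 1) (Fin.snocEquiv (fun _ : Fin (n + 2) => X) (z, y)) =
            W z (y (Fin.last n)) * pathWeight W P n y := fun z => by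
        simp only [pathWeight, Fin.prod_univ_castSucc (n := n), Fin.snocEquiv_apply,
          Fin.succ_castSucc, Fin.succ_last, Fin.snoc_castSucc, Fin.snoc_last]
        rw [← Fin.castSucc_zero, Fin.snoc_castSucc]
        ring
      have h2 : ∀ z : X,
          additive g h (n + 1) (Fin.snocEquiv (fun _ : Fin (n + 2) => X) (z, y)) =
            g z (y (Fin.last n)) + additive g h n y := fun z => by
        simp only [additive, Fin.sum_univ_castSucc (n := n), Fin.snocEquiv_apply,
          Fin.succ_castSucc, Fin.succ_last, Fin.snoc_castSucc, Fin.snoc_last]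
        rw [← Fin.castSucc_zero, Fin.snoc_castSucc]
        ring
      rw [show l * (pathWeight W P n y * Real.exp (θ * additive g h n y) * u (y (Fin.last n))) =
        pathWeight W P n y * Real.exp (θ * additive g h n y) * (l * u (y (Fin.last n))) by ring,
        ← hu, Finset.mul_sum]
      refine Finset.sum_congr rfl fun z _ => ?_
      rw [h1, h2, mul_add, Real.exp_add, tilted, Matrix.of_apply]
      simp only [Fin.snocEquiv_apply, Fin.snoc_last]
      ring
    rw [Finset.sum_congr rfl fun y _ => hstep y, ← Finset.mul_sum, ih, pow_succ]
    ring

/-! ### The eigenvector equation of the tilted matrices -/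

/-- The equations for an eigenpair `(u, l)` of the transpose of the tilted matrix, with the entries
of `u` normalized by their sum. -/
noncomputable def eigenEquation (W : Matrix X X ℝ) (g : X → X → ℝ) (p : ℝ × (X → ℝ) × ℝ) :
    (X → ℝ) × ℝ :=
  (fun x' => ∑ x, tilted W g p.1 x x' * p.2.1 x - p.2.2 * p.2.1 x', ∑ x, p.2.1 x)

theorem contDiff_eigenEquation (W : Matrix X X ℝ) (g : X → X → ℝ) :
    ContDiff ℝ 2 (eigenEquation W g) := by
  unfold eigenEquation tilted
  simp only [Matrix.of_apply]
  fun_prop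

variable [DecidableEq X]

/-! ### The maximum principle -/

/-- A function that is superharmonic for an irreducible chain is constant: the set where it attains
its minimum is closed under transitions of positive probability. -/
theorem const_of_superharmonic {W : Matrix X X ℝ} (hW : W ∈ Matrix.colStochastic ℝ X)
    (hirr : W.IsIrreducible) {v : X → ℝ} (hv : ∀ x', ∑ x, W x x' * v x ≤ v x') (y z : X) :
    v y = v z := by
  obtain ⟨hnn, hsum⟩ := Matrix.mem_colStochastic_iff_sum.1 hW
  have : Nonempty X := ⟨y⟩
  obtain ⟨m, hm⟩ := Finite.exists_min v
  have step : ∀ x x', v x' = v m → 0 < W x x' → v x = v m := by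
    intro x x' hx' hpos
    have h0 : ∑ x, W x x' * (v x - v m) ≤ 0 := by
      have h1 := hv x'
      simp only [mul_sub, Finset.sum_sub_distrib, ← Finset.sum_mul, hsum]
      linarith
    have h2 : ∀ x ∈ Finset.univ, 0 ≤ W x x' * (v x - v m) := fun x _ =>
      mul_nonneg (hnn _ _) (sub_nonneg.2 (hm x))
    have h3 := (Finset.sum_eq_zero_iff_of_nonneg h2).1 (le_antisymm h0 (Finset.sum_nonneg h2)) x
      (Finset.mem_univ x)
    rcases mul_eq_zero.1 h3 with h | h <;> linarith
  have reach : ∀ k : ℕ, ∀ x, 0 < (W ^ k) x m → v x = v m := by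
    intro k
    induction k with
    | zero =>
      intro x hx
      by_cases hxm : x = m
      · rw [hxm]
      · simp [Matrix.one_apply_ne hxm] at hx
    | succ k ih =>
      intro x hx
      rw [pow_succ', Matrix.mul_apply] at hx
      obtain ⟨w, -, hw⟩ := Finset.exists_lt_of_sum_lt
        (f := fun _ => (0 : ℝ)) (s := Finset.univ) (by simpa using hx)
      have hk : 0 ≤ (W ^ k) w m := Matrix.pow_apply_nonneg hnn k w m
      have h1 : 0 < (W ^ k) w m := lt_of_le_of_ne hk fun h => by simp [← h] at hw
      have h2 : 0 < W x w := lt_of_le_of_ne (hnn _ _) fun h => by simp [← h] at hw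
      exact step x w (ih w h1) h2
  have all : ∀ x, v x = v m := fun x => by
    obtain ⟨k, -, hk⟩ := (Matrix.isIrreducible_iff_exists_pow_pos hnn).1 hirr x m
    exact reach k x hk
  rw [all y, all z]

/-- Bordering `Wᵀ - 1` by the constant function and the sum functional gives an injective map.
This is the nondegeneracy needed to continue the eigenvalue `1` of `Wᵀ` to the tilted matrices. -/
theorem bordered_injective {W : Matrix X X ℝ} (hW : W ∈ Matrix.colStochastic ℝ X)
    (hirr : W.IsIrreducible) [Nonempty X] {v : X → ℝ} {μ : ℝ}
    (hv : ∀ x', ∑ x, W x x' * v x - v x' - μ = 0) (hs : ∑ x, v x = 0) : v = 0 ∧ μ = 0 := by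
  have hsum := (Matrix.mem_colStochastic_iff_sum.1 hW).2
  have hconst : ∀ y z, v y = v z := by
    intro y z
    rcases le_total μ 0 with h | h
    · exact const_of_superharmonic hW hirr (fun x' => by linarith [hv x']) y z
    · have := const_of_superharmonic hW hirr (v := -v) (fun x' => by
        simp only [Pi.neg_apply, mul_neg, Finset.sum_neg_distrib]
        linarith [hv x']) y z
      simpa using this
  have hv0 : v = 0 := by
    funext y
    have h1 : ∑ x, v x = Fintype.card X * v y := by
      rw [Finset.sum_congr rfl fun x _ => hconst x y]; simp
    rw [hs] at h1
    simpa using h1.symm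
  refine ⟨hv0, ?_⟩
  obtain ⟨x'⟩ := ‹Nonempty X›
  simpa [hv0] using hv x'

/-! ### The Perron–Frobenius eigenvalue of a matrix with a positive left eigenvector -/

theorem perronEigenvalue_eq_of_pos_eigenvector [Nonempty X] {A : Matrix X X ℝ}
    (hA : ∀ x x', 0 ≤ A x x') {u : X → ℝ} (hu : ∀ x, 0 < u x) {l : ℝ}
    (hl : ∀ x', ∑ x, A x x' * u x = l * u x') : perronEigenvalue A = l := by
  have hl0 : 0 ≤ l := by
    obtain ⟨x'⟩ := ‹Nonempty X›
    have : 0 ≤ l * u x' := by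
      rw [← hl x']
      exact Finset.sum_nonneg fun x _ => mul_nonneg (hA _ _) (hu x).le
    exact nonneg_of_mul_nonneg_left this (hu x')
  have hmem : (l : ℂ) ∈ spectrum ℂ (A.map Complex.ofReal) := by
    rw [spectrum.mem_iff, Matrix.isUnit_iff_isUnit_det, isUnit_iff_ne_zero, not_not,
      ← Matrix.exists_vecMul_eq_zero_iff]
    refine ⟨fun x => (u x : ℂ), ?_, ?_⟩
    · intro h
      obtain ⟨x'⟩ := ‹Nonempty X›
      have := congrFun h x'
      simp [(hu x').ne'] at this
    · rw [Algebra.algebraMap_eq_smul_one, Matrix.vecMul_sub, Matrix.vecMul_smul, Matrix.vecMul_one]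
      funext x'
      have h1 : ((∑ x, A x x' * u x : ℝ) : ℂ) = ((l * u x' : ℝ) : ℂ) := by rw [hl x']
      push_cast at h1
      simp [Matrix.vecMul, dotProduct, ← h1, mul_comm]
  have hle : ∀ μ ∈ spectrum ℂ (A.map Complex.ofReal), ‖μ‖ ≤ l := by
    intro μ hμ
    rw [spectrum.mem_iff, Matrix.isUnit_iff_isUnit_det, isUnit_iff_ne_zero, not_not,
      ← Matrix.exists_mulVec_eq_zero_iff] at hμ
    obtain ⟨v, hv0, hv⟩ := hμ
    rw [Algebra.algebraMap_eq_smul_one, Matrix.sub_mulVec, Matrix.smul_mulVec, Matrix.one_mulVec,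
      sub_eq_zero] at hv
    -- Pairing the moduli of an eigenvector for `μ` with `u` compares `‖μ‖` to `l`.
    have hpt : ∀ x, ‖μ‖ * ‖v x‖ ≤ ∑ x', A x x' * ‖v x'‖ := by
      intro x
      have h1 := congrFun hv x
      simp only [Pi.smul_apply, smul_eq_mul, Matrix.mulVec, dotProduct, Matrix.map_apply] at h1
      rw [← norm_mul, h1]
      refine (norm_sum_le _ _).trans (le_of_eq (Finset.sum_congr rfl fun x' _ => ?_))
      rw [norm_mul, Complex.norm_real, Real.norm_of_nonneg (hA _ _)]
    have hsum : ‖μ‖ * ∑ x, u x * ‖v x‖ ≤ l * ∑ x, u x * ‖v x‖ := by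
      calc ‖μ‖ * ∑ x, u x * ‖v x‖ = ∑ x, u x * (‖μ‖ * ‖v x‖) := by
            rw [Finset.mul_sum]; exact Finset.sum_congr rfl fun x _ => by ring
        _ ≤ ∑ x, u x * ∑ x', A x x' * ‖v x'‖ :=
            Finset.sum_le_sum fun x _ => mul_le_mul_of_nonneg_left (hpt x) (hu x).le
        _ = ∑ x', (∑ x, A x x' * u x) * ‖v x'‖ := by
            simp only [Finset.mul_sum, Finset.sum_mul]
            rw [Finset.sum_comm]
            exact Finset.sum_congr rfl fun _ _ => Finset.sum_congr rfl fun _ _ => by ring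
        _ = l * ∑ x, u x * ‖v x‖ := by
            rw [Finset.mul_sum]; exact Finset.sum_congr rfl fun x _ => by rw [hl]; ring
    obtain ⟨y, hy⟩ := Function.ne_iff.1 hv0
    have hpos : 0 < ∑ x, u x * ‖v x‖ :=
      Finset.sum_pos' (fun x _ => mul_nonneg (hu x).le (norm_nonneg _))
        ⟨y, Finset.mem_univ y, mul_pos (hu y) (norm_pos_iff.2 hy)⟩
    exact le_of_mul_le_mul_right hsum hpos
  have hrad : spectralRadius ℂ (A.map Complex.ofReal) = ENNReal.ofReal l := by
    refine le_antisymm (iSup₂_le fun μ hμ => ?_) ?_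
    · have h1 := ENNReal.ofReal_le_ofReal (hle μ hμ)
      rwa [ofReal_norm] at h1
    · refine le_trans (le_of_eq ?_) (le_iSup₂ (f := fun k _ => (‖k‖₊ : ENNReal)) (l : ℂ) hmem)
      change _ = ‖(l : ℂ)‖ₑ
      rw [← ofReal_norm, Complex.norm_real, Real.norm_of_nonneg hl0]
  rw [perronEigenvalue, hrad, ENNReal.toReal_ofReal hl0]

/-! ### Smooth continuation of the Perron–Frobenius eigenvector -/

/-- The partial derivative of the eigenvector equations in the eigenpair, at `θ = 0` and the
eigenpair `(1, 1)`. -/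
theorem fderiv_eigenEquation_inr {W : Matrix X X ℝ} (hW : W ∈ Matrix.colStochastic ℝ X)
    (g : X → X → ℝ) (v : X → ℝ) (μ : ℝ) :
    (fderiv ℝ (eigenEquation W g) (0, 1, 1) ∘L .inr ℝ ℝ ((X → ℝ) × ℝ)) (v, μ) =
      (fun x' => ∑ x, W x x' * v x - v x' - μ, ∑ x, v x) := by
  have hsum := (Matrix.mem_colStochastic_iff_sum.1 hW).2
  have hF : HasFDerivAt (eigenEquation W g) (fderiv ℝ (eigenEquation W g) (0, 1, 1)) (0, 1, 1) :=
    ((contDiff_eigenEquation W g).differentiable (by norm_num) _).hasFDerivAt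
  have hline : HasDerivAt (fun s : ℝ => ((0 : ℝ), (1 : X → ℝ) + s • v, (1 : ℝ) + s * μ))
      (0, v, μ) 0 := by
    refine (hasDerivAt_const _ _).prodMk (HasDerivAt.prodMk ?_ ?_)
    · simpa using ((hasDerivAt_id (0 : ℝ)).smul_const v).const_add (1 : X → ℝ)
    · simpa using ((hasDerivAt_id (0 : ℝ)).mul_const μ).const_add (1 : ℝ)
  have h1 := HasFDerivAt.comp_hasDerivAt_of_eq (0 : ℝ) hF hline (by simp)
  have h2 : HasDerivAt (eigenEquation W g ∘
      fun s : ℝ => ((0 : ℝ), (1 : X → ℝ) + s • v, (1 : ℝ) + s * μ))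
      (fun x' => ∑ x, W x x' * v x - v x' - μ, ∑ x, v x) 0 := by
    refine HasDerivAt.prodMk (hasDerivAt_pi.2 fun x' => ?_) ?_
    · have hlin : ∀ y, HasDerivAt (fun s : ℝ => 1 + s * v y) (v y) 0 := fun y => by
        simpa using ((hasDerivAt_id (0 : ℝ)).mul_const (v y)).const_add (1 : ℝ)
      have hμ : HasDerivAt (fun s : ℝ => 1 + s * μ) μ 0 := by
        simpa using ((hasDerivAt_id (0 : ℝ)).mul_const μ).const_add (1 : ℝ)
      have := (HasDerivAt.fun_sum (u := Finset.univ)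
        fun y _ => (hlin y).const_mul (W y x')).sub (hμ.mul (hlin x'))
      convert! this using 1
      · funext s; simp [tilted]
      · simp; ring
    · have := HasDerivAt.fun_sum (u := Finset.univ)
        fun y _ => ((hasDerivAt_id (0 : ℝ)).mul_const (v y)).const_add (1 : ℝ)
      simpa using this
  exact h1.unique h2

theorem isInvertible_fderiv_eigenEquation [Nonempty X] {W : Matrix X X ℝ}
    (hW : W ∈ Matrix.colStochastic ℝ X) (hirr : W.IsIrreducible) (g : X → X → ℝ) :
    (fderiv ℝ (eigenEquation W g) (0, 1, 1) ∘L .inr ℝ ℝ ((X → ℝ) × ℝ)).IsInvertible := by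
  set T := fderiv ℝ (eigenEquation W g) (0, 1, 1) ∘L .inr ℝ ℝ ((X → ℝ) × ℝ) with hT
  have hinj : Function.Injective (T : ((X → ℝ) × ℝ) →ₗ[ℝ] ((X → ℝ) × ℝ)) := by
    rw [← LinearMap.ker_eq_bot, LinearMap.ker_eq_bot']
    rintro ⟨v, μ⟩ h
    change T (v, μ) = 0 at h
    rw [hT, fderiv_eigenEquation_inr hW] at h
    obtain ⟨h1, h2⟩ := Prod.mk_eq_zero.1 h
    obtain ⟨rfl, rfl⟩ := bordered_injective hW hirr (fun x' => congrFun h1 x') h2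
    rfl
  refine ⟨(LinearEquiv.ofInjectiveEndo _ hinj).toContinuousLinearEquiv, ?_⟩
  exact ContinuousLinearMap.ext fun _ => rfl

/-- Near `θ = 0` the transposed tilted matrix has a positive eigenvector and an eigenvalue that
depend twice continuously differentiably on `θ` and start from the eigenpair `(1, 1)`. -/
theorem exists_smooth_eigenpair [Nonempty X] {W : Matrix X X ℝ}
    (hW : W ∈ Matrix.colStochastic ℝ X) (hirr : W.IsIrreducible) (g : X → X → ℝ) :
    ∃ (u : ℝ → X → ℝ) (l : ℝ → ℝ), ContDiffAt ℝ 2 u 0 ∧ ContDiffAt ℝ 2 l 0 ∧ u 0 = 1 ∧ l 0 = 1 ∧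
      (∀ᶠ θ in 𝓝 0, ∀ x', ∑ x, tilted W g θ x x' * u θ x = l θ * u θ x') := by
  have hc : ContDiffAt ℝ 2 (eigenEquation W g) (0, 1, 1) := (contDiff_eigenEquation W g).contDiffAt
  have hi := isInvertible_fderiv_eigenEquation hW hirr g
  set ψ := hc.implicitFunction two_ne_zero hi
  have h1 : ContDiffAt ℝ 2 ψ 0 := hc.contDiffAt_implicitFunction two_ne_zero hi
  have h0 : ψ 0 = (1, 1) := hc.implicitFunction_apply_self two_ne_zero hi
  refine ⟨fun θ => (ψ θ).1, fun θ => (ψ θ).2, h1.fst, h1.snd, by simp [h0], by simp [h0], ?_⟩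
  filter_upwards [hc.eventually_apply_implicitFunction two_ne_zero hi] with θ hθ x'
  have h2 := congrFun (congrArg Prod.fst hθ) x'
  have hsum := (Matrix.mem_colStochastic_iff_sum.1 hW).2
  have h3 : (eigenEquation W g (0, 1, 1)).1 x' = 0 := by
    simp [eigenEquation, tilted, hsum]
  rw [h3] at h2
  exact sub_eq_zero.1 h2

/-! ### The potential and its second derivative -/

/-- The eigenvector equation in logarithmic form: near `θ = 0` the weights
`W x x' * exp (θ * g x x' + w θ x - w θ x' - φ θ)`, with `φ` the potential, form a stochastic
matrix, where `exp (w θ)` is the positive eigenvector of the transposed tilted matrix. -/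
theorem exists_log_eigenvector [Nonempty X] {W : Matrix X X ℝ}
    (hW : W ∈ Matrix.colStochastic ℝ X) (hirr : W.IsIrreducible) (g : X → X → ℝ) :
    ContDiffAt ℝ 2 (potential W g) 0 ∧ potential W g 0 = 0 ∧
    ∃ w : ℝ → X → ℝ, ContDiffAt ℝ 2 w 0 ∧ w 0 = 0 ∧
      ∀ᶠ θ in 𝓝 0, ∀ x', ∑ x, W x x' *
        Real.exp (θ * g x x' + w θ x - w θ x' - potential W g θ) = 1 := by
  obtain ⟨u, l, hu, hl, hu0, hl0, heq⟩ := exists_smooth_eigenpair hW hirr g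
  have hnn := (Matrix.mem_colStochastic_iff_sum.1 hW).1
  have hux : ∀ x, ContDiffAt ℝ 2 (fun θ => u θ x) 0 := contDiffAt_pi.1 hu
  have hupos : ∀ᶠ θ in 𝓝 (0 : ℝ), ∀ x, 0 < u θ x := by
    refine eventually_all.2 fun x => (hux x).continuousAt.eventually (lt_mem_nhds ?_)
    simp [hu0]
  have hlpos : ∀ᶠ θ in 𝓝 (0 : ℝ), 0 < l θ :=
    hl.continuousAt.eventually (lt_mem_nhds (by simp [hl0]))
  have hpot : ∀ᶠ θ in 𝓝 (0 : ℝ), potential W g θ = Real.log (l θ) := by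
    filter_upwards [hupos, heq] with θ h1 h2
    have hA : ∀ x x', 0 ≤ tilted W g θ x x' := fun x x' =>
      mul_nonneg (hnn x x') (Real.exp_pos _).le
    rw [potential, perronEigenvalue_eq_of_pos_eigenvector hA h1 h2]
  refine ⟨(hl.log (by simp [hl0])).congr_of_eventuallyEq hpot, ?_,
    fun θ x => Real.log (u θ x), ?_, ?_, ?_⟩
  · rw [hpot.self_of_nhds, hl0, Real.log_one]
  · exact contDiffAt_pi.2 fun x => (hux x).log (by simp [hu0])
  · funext x; simp [hu0]
  · filter_upwards [hupos, hlpos, hpot, heq] with θ h1 h2 h3 h4 x'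
    have h5 : ∀ x, W x x' * Real.exp (θ * g x x' + Real.log (u θ x) - Real.log (u θ x') -
        potential W g θ) = tilted W g θ x x' * u θ x * (l θ * u θ x')⁻¹ := fun x => by
      rw [h3, Real.exp_sub, Real.exp_sub, Real.exp_add, Real.exp_log (h1 x), Real.exp_log (h1 x'),
        Real.exp_log h2, tilted, Matrix.of_apply]
      field_simp
    rw [Finset.sum_congr rfl fun x _ => h5 x, ← Finset.sum_mul, h4 x',
      mul_inv_cancel₀ (mul_pos h2 (h1 x')).ne']

/-- Otherwise the second derivative of the logarithmic eigenvector would be superharmonic, hence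
constant, and its first derivative would exhibit `g` as degenerate. -/
theorem deriv_deriv_potential_pos [Nonempty X] {W : Matrix X X ℝ}
    (hW : W ∈ Matrix.colStochastic ℝ X) (hirr : W.IsIrreducible) {g : X → X → ℝ}
    (hg : Nondegenerate W g) : 0 < deriv (deriv (potential W g)) 0 := by
  obtain ⟨hnn, hsum⟩ := Matrix.mem_colStochastic_iff_sum.1 hW
  obtain ⟨hφ, hφ0, w, hw, hw0, heq⟩ := exists_log_eigenvector hW hirr g
  have hwx : ∀ x, ContDiffAt ℝ 2 (fun θ => w θ x) 0 := contDiffAt_pi.1 hw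
  set φ := potential W g
  set w' : X → ℝ → ℝ := fun x => deriv fun θ => w θ x
  set w'' : X → ℝ := fun x => deriv (w' x) 0
  have key : ∀ x', ∑ x, W x x' * ((g x x' + w' x 0 - w' x' 0 - deriv φ 0) ^ 2 +
      (w'' x - w'' x' - deriv (deriv φ) 0)) = 0 := by
    intro x'
    refine sum_deriv_sq_add_deriv_deriv Finset.univ (fun x => W x x')
      (ψ := fun x θ => θ * g x x' + w θ x - w θ x' - φ θ)
      (ψ' := fun x θ => g x x' + w' x θ - w' x' θ - deriv φ θ)
      (ψ'' := fun x => w'' x - w'' x' - deriv (deriv φ) 0) ?_ ?_ ?_ ?_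
    · intro x; simp [hw0, hφ0]
    · intro x
      filter_upwards [(hwx x).eventually_hasDerivAt_deriv, (hwx x').eventually_hasDerivAt_deriv,
        hφ.eventually_hasDerivAt_deriv] with θ h1 h2 h3
      exact ((((hasDerivAt_id θ).mul_const (g x x')).congr_deriv (one_mul _)).add h1 |>.sub h2).sub
        h3
    · intro x
      exact ((((hwx x).hasDerivAt_deriv_deriv).const_add (g x x')).sub
        ((hwx x').hasDerivAt_deriv_deriv)).sub hφ.hasDerivAt_deriv_deriv
    · filter_upwards [heq] with θ hθ using hθ x'
  have key2 : ∀ x', ∑ x, W x x' * (g x x' + w' x 0 - w' x' 0 - deriv φ 0) ^ 2 +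
      ∑ x, W x x' * w'' x = w'' x' + deriv (deriv φ) 0 := by
    intro x'
    have := key x'
    simp only [mul_add, mul_sub, Finset.sum_add_distrib, Finset.sum_sub_distrib, ← Finset.sum_mul,
      hsum] at this
    linarith
  have hsq : ∀ x' x, 0 ≤ W x x' * (g x x' + w' x 0 - w' x' 0 - deriv φ 0) ^ 2 := fun x' x =>
    mul_nonneg (hnn _ _) (sq_nonneg _)
  by_contra! hneg
  have hconst := const_of_superharmonic hW hirr (v := w'') fun x' => by
    have := key2 x'
    have := Finset.sum_nonneg fun x (_ : x ∈ Finset.univ) => hsq x' x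
    linarith
  refine hg ⟨fun x => -w' x 0, deriv φ 0, fun x x' hpos => ?_⟩
  have h1 : ∑ x, W x x' * (g x x' + w' x 0 - w' x' 0 - deriv φ 0) ^ 2 ≤ 0 := by
    have h2 := key2 x'
    have h3 : ∑ x, W x x' * w'' x = w'' x' := by
      simp only [fun x => hconst x x', ← Finset.sum_mul, hsum, one_mul]
    linarith
  have h2 := (Finset.sum_eq_zero_iff_of_nonneg fun x _ => hsq x' x).1
    (le_antisymm h1 (Finset.sum_nonneg fun x _ => hsq x' x)) x (Finset.mem_univ x)
  have h3 : g x x' + w' x 0 - w' x' 0 - deriv φ 0 = 0 := by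
    simpa [hpos.ne'] using h2
  linarith

/-! ### Asymptotics of the cumulant generating function -/

theorem pathWeight_nonneg {W : Matrix X X ℝ} (hW : W ∈ Matrix.colStochastic ℝ X) {P : X → ℝ}
    (hP : P ∈ stdSimplex ℝ X) (n : ℕ) (x : Fin (n + 1) → X) : 0 ≤ pathWeight W P n x :=
  mul_nonneg (Finset.prod_nonneg fun _ _ => Matrix.nonneg_of_mem_colStochastic hW) (hP.1 _)

/-- The cumulant generating function of the additive functional is `n * φ θ` up to an error that
is bounded uniformly in `n` and in `θ` near `0`: the logarithms of the eigenvector at both ends of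
the path and the term `θ * h` contribute at most `1` each. -/
theorem log_mgf_additive_bound [Nonempty X] {W : Matrix X X ℝ}
    (hW : W ∈ Matrix.colStochastic ℝ X) (hirr : W.IsIrreducible) (g : X → X → ℝ) {P : X → ℝ}
    (hP : P ∈ stdSimplex ℝ X) (h : X → ℝ) :
    ∀ᶠ θ in 𝓝 (0 : ℝ), ∀ n : ℕ,
      0 < ∑ x, pathWeight W P n x * Real.exp (θ * additive g h n x) ∧
      |Real.log (∑ x, pathWeight W P n x * Real.exp (θ * additive g h n x)) -
        n * potential W g θ| ≤ 3 := by
  obtain ⟨-, -, w, hw, hw0, heq⟩ := exists_log_eigenvector hW hirr g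
  have hwx : ∀ᶠ θ in 𝓝 (0 : ℝ), ∀ x, |w θ x| < 1 := by
    refine eventually_all.2 fun x => ?_
    exact (continuousAt_pi.1 hw.continuousAt x).abs.eventually (gt_mem_nhds (by simp [hw0]))
  have hhx : ∀ᶠ θ in 𝓝 (0 : ℝ), ∀ x, |θ * h x| < 1 := by
    refine eventually_all.2 fun x => ?_
    have : Continuous fun θ : ℝ => |θ * h x| := by fun_prop
    exact this.continuousAt.eventually (gt_mem_nhds (by simp))
  filter_upwards [hwx, hhx, heq] with θ h1 h2 h3 n
  set φ := potential W g θ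
  have hu : ∀ x', ∑ x, tilted W g θ x x' * Real.exp (w θ x) =
      Real.exp φ * Real.exp (w θ x') := by
    intro x'
    have h4 : ∀ x, tilted W g θ x x' * Real.exp (w θ x) =
        W x x' * Real.exp (θ * g x x' + w θ x - w θ x' - φ) *
          (Real.exp φ * Real.exp (w θ x')) := fun x => by
      rw [tilted, Matrix.of_apply, mul_assoc, mul_assoc, ← Real.exp_add, ← Real.exp_add,
        ← Real.exp_add]
      ring_nf
    rw [Finset.sum_congr rfl fun x _ => h4 x, ← Finset.sum_mul, h3 x', one_mul]
  have hZ := sum_pathWeight_mul_exp_mul_eigenvector hu P h n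
  rw [← Real.exp_nat_mul] at hZ
  set M := ∑ x, pathWeight W P n x * Real.exp (θ * additive g h n x)
  set Z := ∑ x : Fin (n + 1) → X, pathWeight W P n x * Real.exp (θ * additive g h n x) *
      Real.exp (w θ (x (Fin.last n)))
  set I := ∑ x, P x * Real.exp (θ * h x) * Real.exp (w θ x)
  have hpw := pathWeight_nonneg hW hP n
  have hZM : Z ≤ M * Real.exp 1 := by
    rw [Finset.sum_mul]
    refine Finset.sum_le_sum fun x _ => mul_le_mul_of_nonneg_left ?_
      (mul_nonneg (hpw x) (Real.exp_pos _).le)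
    exact Real.exp_le_exp.2 (abs_lt.1 (h1 _)).2.le
  have hMZ : M * Real.exp (-1) ≤ Z := by
    rw [Finset.sum_mul]
    refine Finset.sum_le_sum fun x _ => mul_le_mul_of_nonneg_left ?_
      (mul_nonneg (hpw x) (Real.exp_pos _).le)
    exact Real.exp_le_exp.2 (abs_lt.1 (h1 _)).1.le
  have hI : I ≤ Real.exp 2 := by
    calc I ≤ ∑ x, P x * Real.exp 2 := Finset.sum_le_sum fun x _ => by
          rw [mul_assoc, ← Real.exp_add]
          refine mul_le_mul_of_nonneg_left (Real.exp_le_exp.2 ?_) (hP.1 x)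
          linarith [(abs_lt.1 (h1 x)).2, (abs_lt.1 (h2 x)).2]
      _ = Real.exp 2 := by rw [← Finset.sum_mul, hP.2, one_mul]
  have hI' : Real.exp (-2) ≤ I := by
    calc Real.exp (-2) = ∑ x, P x * Real.exp (-2) := by rw [← Finset.sum_mul, hP.2, one_mul]
      _ ≤ I := Finset.sum_le_sum fun x _ => by
          rw [mul_assoc, ← Real.exp_add]
          refine mul_le_mul_of_nonneg_left (Real.exp_le_exp.2 ?_) (hP.1 x)
          linarith [(abs_lt.1 (h1 x)).1, (abs_lt.1 (h2 x)).1]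
  have hlow : Real.exp (n * φ - 3) ≤ M := by
    have : Real.exp (n * φ - 3) * Real.exp 1 ≤ M * Real.exp 1 := by
      refine le_trans ?_ hZM
      rw [hZ, ← Real.exp_add, show n * φ - 3 + 1 = n * φ + -2 by ring, Real.exp_add]
      gcongr
    exact le_of_mul_le_mul_right this (Real.exp_pos _)
  have hup : M ≤ Real.exp (n * φ + 3) := by
    have : M * Real.exp (-1) ≤ Real.exp (n * φ + 3) * Real.exp (-1) := by
      refine hMZ.trans ?_
      rw [hZ, ← Real.exp_add, show n * φ + 3 + -1 = n * φ + 2 by ring, Real.exp_add]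
      gcongr
    exact le_of_mul_le_mul_right this (Real.exp_pos _)
  have hM : 0 < M := (Real.exp_pos _).trans_le hlow
  refine ⟨hM, abs_le.2 ⟨?_, ?_⟩⟩
  · linarith [(Real.le_log_iff_exp_le hM).2 hlow]
  · linarith [(Real.log_le_iff_le_exp hM).2 hup]

/-! ### The moderate deviation principle for additive functionals -/

/-- At the tilt `s * n ^ (-t)` the second-order expansion of the potential is the only
contribution that survives division by `n ^ (1 - 2 * t)`. -/
theorem tendsto_scaled_cgf [Nonempty X] {W : Matrix X X ℝ} (hW : W ∈ Matrix.colStochastic ℝ X)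
    (hirr : W.IsIrreducible) (g : X → X → ℝ) {P : X → ℝ} (hP : P ∈ stdSimplex ℝ X) (h : X → ℝ)
    {t : ℝ} (ht0 : 0 < t) (ht : t < 1 / 2) (s : ℝ) :
    (∀ᶠ n : ℕ in atTop, 0 < ∑ x, pathWeight W P n x * Real.exp ((n : ℝ) ^ (1 - 2 * t) * s *
        ((additive g h n x - n * deriv (potential W g) 0) / (n : ℝ) ^ (1 - t)))) ∧
    Tendsto (fun n : ℕ => 1 / (n : ℝ) ^ (1 - 2 * t) * Real.log (∑ x, pathWeight W P n x *
      Real.exp ((n : ℝ) ^ (1 - 2 * t) * s *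
        ((additive g h n x - n * deriv (potential W g) 0) / (n : ℝ) ^ (1 - t)))))
      atTop (𝓝 (deriv (deriv (potential W g)) 0 * s ^ 2 / 2)) := by
  obtain ⟨hφ, hφ0, -⟩ := exists_log_eigenvector hW hirr g
  set φ := potential W g
  set θ : ℕ → ℝ := fun n => s * (n : ℝ) ^ (-t) with hθ_def
  have hθ : Tendsto θ atTop (𝓝 0) := by
    have := ((tendsto_rpow_neg_atTop ht0).comp tendsto_natCast_atTop_atTop).const_mul s
    simpa using this
  have ha : Tendsto (fun n : ℕ => (n : ℝ) ^ (1 - 2 * t)) atTop atTop :=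
    (tendsto_rpow_atTop (by linarith)).comp tendsto_natCast_atTop_atTop
  have hbd := hθ.eventually (log_mgf_additive_bound hW hirr g hP h)
  -- Centring and scaling amount to the tilt `θ n` and a deterministic factor.
  have hsum : ∀ᶠ n : ℕ in atTop, ∑ x, pathWeight W P n x * Real.exp ((n : ℝ) ^ (1 - 2 * t) * s *
        ((additive g h n x - n * deriv φ 0) / (n : ℝ) ^ (1 - t))) =
      Real.exp (-(θ n * (n * deriv φ 0))) *
        ∑ x, pathWeight W P n x * Real.exp (θ n * additive g h n x) := by
    filter_upwards [eventually_gt_atTop 0] with n hn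
    have hn' : (0 : ℝ) < n := by exact_mod_cast hn
    rw [Finset.mul_sum]
    refine Finset.sum_congr rfl fun x _ => ?_
    rw [mul_left_comm, ← Real.exp_add]
    have e : (n : ℝ) ^ (1 - 2 * t) = (n : ℝ) ^ (-t) * (n : ℝ) ^ (1 - t) := by
      rw [← Real.rpow_add hn']; ring_nf
    have hne : (n : ℝ) ^ (1 - t) ≠ 0 := (Real.rpow_pos_of_pos hn' _).ne'
    rw [e, hθ_def]
    congr 2
    field_simp
    ring
  have hsq : (fun n : ℕ => (n : ℝ) ^ (2 * t) * θ n ^ 2) =ᶠ[atTop] fun _ => s ^ 2 := by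
    filter_upwards [eventually_gt_atTop 0] with n hn
    have hn' : (0 : ℝ) < n := by exact_mod_cast hn
    rw [hθ_def]
    simp only [mul_pow]
    rw [← Real.rpow_natCast ((n : ℝ) ^ (-t)), ← Real.rpow_mul hn'.le, mul_left_comm,
      ← Real.rpow_add hn']
    ring_nf
    simp
  constructor
  · filter_upwards [hsum, hbd] with n h1 h2
    rw [h1]
    exact mul_pos (Real.exp_pos _) (h2 n).1
  -- The second-order expansion of the potential at the tilt `θ n`.
  have htaylor : Tendsto (fun n : ℕ => (n : ℝ) ^ (2 * t) *
      (φ (θ n) - deriv φ 0 * θ n - deriv (deriv φ) 0 * θ n ^ 2 / 2)) atTop (𝓝 0) := by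
    have h1 := (hφ.isLittleO_sq_sub_taylor hφ0).comp_tendsto hθ
    have h2 := (Asymptotics.isBigO_refl (fun n : ℕ => (n : ℝ) ^ (2 * t)) atTop).mul_isLittleO h1
    have h3 : (fun n : ℕ => (n : ℝ) ^ (2 * t) *
        (φ (θ n) - deriv φ 0 * θ n - deriv (deriv φ) 0 * θ n ^ 2 / 2)) =o[atTop] fun _ => s ^ 2 :=
      h2.trans_eventuallyEq hsq
    exact (Asymptotics.isLittleO_one_iff ℝ).1
      (h3.trans_isBigO (Asymptotics.isBigO_const_const _ one_ne_zero _))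
  have herr : Tendsto (fun n : ℕ => 1 / (n : ℝ) ^ (1 - 2 * t) *
      (Real.log (∑ x, pathWeight W P n x * Real.exp (θ n * additive g h n x)) - n * φ (θ n)))
      atTop (𝓝 0) := by
    refine squeeze_zero_norm' (a := fun n : ℕ => 3 / (n : ℝ) ^ (1 - 2 * t)) ?_
      (ha.const_div_atTop 3)
    filter_upwards [hbd, ha.eventually_gt_atTop 0] with n h1 h2
    rw [norm_mul, Real.norm_of_nonneg (by positivity), one_div_mul_eq_div]
    gcongr
    exact (h1 n).2
  have hlim := (htaylor.add herr).add_const (deriv (deriv φ) 0 * s ^ 2 / 2)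
  rw [zero_add, zero_add] at hlim
  refine hlim.congr' ?_
  filter_upwards [hsum, hbd, hsq, eventually_gt_atTop 0] with n h1 h2 h3 hn
  have hn' : (0 : ℝ) < n := by exact_mod_cast hn
  rw [h1, Real.log_mul (Real.exp_pos _).ne' (h2 n).1.ne', Real.log_exp]
  have e1 : (n : ℝ) ^ (2 * t) = n / (n : ℝ) ^ (1 - 2 * t) := by
    rw [eq_div_iff (Real.rpow_pos_of_pos hn' _).ne', ← Real.rpow_add hn']; simp
  rw [← h3, e1]
  ring

theorem tendsto_log_upper_tail [Nonempty X] {W : Matrix X X ℝ}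
    (hW : W ∈ Matrix.colStochastic ℝ X) (hirr : W.IsIrreducible) {g : X → X → ℝ}
    (hg : Nondegenerate W g) {P : X → ℝ} (hP : P ∈ stdSimplex ℝ X) (h : X → ℝ)
    {t : ℝ} (ht0 : 0 < t) (ht : t < 1 / 2) {δ : ℝ} (hδ : 0 < δ) :
    Tendsto (fun n : ℕ => -(1 / (n : ℝ) ^ (1 - 2 * t)) * Real.log (pathProb W P n
        {x | additive g h n x - (n : ℝ) * deriv (potential W g) 0 ≥ (n : ℝ) ^ (1 - t) * δ}))
      atTop (𝓝 (δ ^ 2 / (2 * deriv (deriv (potential W g)) 0))) := by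
  have ha : Tendsto (fun n : ℕ => (n : ℝ) ^ (1 - 2 * t)) atTop atTop :=
    (tendsto_rpow_atTop (by linarith)).comp tendsto_natCast_atTop_atTop
  have hcgf := tendsto_scaled_cgf hW hirr g hP h ht0 ht
  have := (tendsto_log_tail_of_quadratic_cgf (pathWeight_nonneg hW hP) ha
    (deriv_deriv_potential_pos hW hirr hg) (fun s => (hcgf s).1) (fun s => (hcgf s).2) hδ).neg
  rw [neg_neg] at this
  refine this.congr' ?_
  filter_upwards [eventually_gt_atTop 0] with n hn
  have hn' : (0 : ℝ) < n := by exact_mod_cast hn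
  have hE : {x | δ ≤ (additive g h n x - n * deriv (potential W g) 0) / (n : ℝ) ^ (1 - t)} =
      {x | additive g h n x - (n : ℝ) * deriv (potential W g) 0 ≥ (n : ℝ) ^ (1 - t) * δ} := by
    ext x
    simp only [Set.mem_ofPred_eq, ge_iff_le]
    rw [le_div_iff₀ (Real.rpow_pos_of_pos hn' _), mul_comm]
  rw [hE, neg_mul, pathProb]

/-! ### The potential under a sign change of the functional -/

theorem potential_neg (W : Matrix X X ℝ) (g : X → X → ℝ) :
    potential W (-g) = fun θ => potential W g (-θ) := by
  funext θ
  simp [potential, tilted]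

theorem deriv_potential_neg (W : Matrix X X ℝ) (g : X → X → ℝ) :
    deriv (potential W (-g)) = fun θ => -deriv (potential W g) (-θ) := by
  funext θ
  rw [potential_neg, deriv_comp_neg]

theorem deriv_deriv_potential_neg (W : Matrix X X ℝ) (g : X → X → ℝ) :
    deriv (deriv (potential W (-g))) 0 = deriv (deriv (potential W g)) 0 := by
  rw [deriv_potential_neg, deriv.fun_neg, deriv_comp_neg (f := deriv (potential W g))]
  simp

end MarkovMDP

theorem mainTheorem5 {X : Type*} [Fintype X] [DecidableEq X]
    (W : Matrix X X ℝ) (hW : W ∈ Matrix.colStochastic ℝ X) (hWerg : MarkovMDP.IsErgodic W)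
    (g : X → X → ℝ) (hg : MarkovMDP.Nondegenerate W g)
    (P : X → ℝ) (hP : P ∈ stdSimplex ℝ X) (h : X → ℝ)
    (t : ℝ) (ht0 : 0 < t) (ht : t < 1 / 2) (δ : ℝ) (hδ : 0 < δ) :
    ContDiffAt ℝ 2 (MarkovMDP.potential W g) 0 ∧
    0 < deriv (deriv (MarkovMDP.potential W g)) 0 ∧
    Tendsto
      (fun n : ℕ => -(1 / (n : ℝ) ^ (1 - 2 * t)) *
        Real.log (MarkovMDP.pathProb W P n
          {x | MarkovMDP.additive g h n x - (n : ℝ) * deriv (MarkovMDP.potential W g) 0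
            ≥ (n : ℝ) ^ (1 - t) * δ}))
      atTop (𝓝 (δ ^ 2 / (2 * deriv (deriv (MarkovMDP.potential W g)) 0))) ∧
    Tendsto
      (fun n : ℕ => -(1 / (n : ℝ) ^ (1 - 2 * t)) *
        Real.log (MarkovMDP.pathProb W P n
          {x | MarkovMDP.additive g h n x - (n : ℝ) * deriv (MarkovMDP.potential W g) 0
            ≤ -((n : ℝ) ^ (1 - t) * δ)}))
      atTop (𝓝 (δ ^ 2 / (2 * deriv (deriv (MarkovMDP.potential W g)) 0))) := by
  have : Nonempty X := by
    by_contra hX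
    rw [not_nonempty_iff] at hX
    simpa using hP.2
  have hirr := hWerg.1
  refine ⟨(MarkovMDP.exists_log_eigenvector hW hirr g).1,
    MarkovMDP.deriv_deriv_potential_pos hW hirr hg,
    MarkovMDP.tendsto_log_upper_tail hW hirr hg hP h ht0 ht hδ, ?_⟩
  -- The lower tail is the upper tail of the functional with the signs of `g` and `h` changed.
  have hneg := MarkovMDP.tendsto_log_upper_tail hW hirr hg.neg hP (-h) ht0 ht hδ
  rw [MarkovMDP.deriv_deriv_potential_neg] at hneg
  refine hneg.congr fun n => ?_
  congr 3
  ext x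
  simp only [Set.mem_ofPred_eq, ge_iff_le, MarkovMDP.additive_neg, MarkovMDP.deriv_potential_neg,
    neg_zero]
  constructor <;> intro hx <;> linarith
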